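/- Let $n,k\ge 1$ be integers, let $p\in[1,\infty)$, and put $c_{n,k}=\binom{n+k-1}{k}$. Let $\sigma$ be the normalized Euclidean surface measure on the unit sphere $\mathbb S^n=\{\xi\in\mathbb C^n:\|\xi\|_2=1\}$ of $\mathbb C^n$. For a linear operator $T$ on a finite-dimensional complex Hilbert space let $|T|=(T^*T)^{1/2}$ and let $\|T\|_{(p)}=\big[\operatorname{tr}(|T|^p)\big]^{1/p}$ be its Schatten $p$-norm. For $A\in M_n(\mathbb C)$ let $\vee^kA$ be its $k$-th symmetric tensor power, i.e. the restriction of $A\otimes\cdots\otimes A$ ($k$ factors) to the subspace of symmetric tensors (those invariant under all permutations of the factors) of $(\mathbb C^n)^{\otimes k}$, with the inner product inherited from $(\mathbb C^n)^{\otimes k}$; and let $$N_k^{(p)}(A)=\Big(\int_{\mathbb S^n}\langle |A|^p\xi,\xi\rangle^k\,d\sigma(\xi)\Big)^{1/(pk)}.$$ Then $$c_{n,k}^{1/(kp)}\,N_k^{(p)}(A)=\big\|\vee^kA\big\|_{(p)}^{1/k}\qquad\text{for all }A\in M_n(\mathbb C).$$ Moreover, $A\mapsto\|\vee^kA\|_{(p)}^{1/k}$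 is a unitarily invariant norm on $M_n(\mathbb C)$, i.e. it is a norm $\tau$ on the complex vector space $M_n(\mathbb C)$ with $\tau(UAV)=\tau(A)$ for all $A\in M_n(\mathbb C)$ and all unitary $U,V\in M_n(\mathbb C)$. -/

import Mathlib

open MeasureTheory

noncomputable section

namespace SymPower

/-- The operator `|T|^p`, where `|T| = (T* T)^{1/2}`, defined by the continuous functional
calculus of the C*-algebra of operators on a complex Hilbert space. -/
def absRpow {E : Type*} [NormedAddCommGroup E] [InnerProductSpace ℂ E] [CompleteSpace E]
    (T : E →L[ℂ] E) (p : ℝ) : E →L[ℂ] E :=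
  CFC.rpow (CFC.abs T) p

/-- The Schatten `p`-norm `(tr |T|^p)^{1/p}` of an operator on a finite-dimensional complex
Hilbert space. The trace is a nonnegative real number, so its real part is taken. -/
def schattenNorm {E : Type*} [NormedAddCommGroup E] [InnerProductSpace ℂ E]
    [FiniteDimensional ℂ E] [CompleteSpace E] (p : ℝ) (T : E →L[ℂ] E) : ℝ :=
  (LinearMap.trace ℂ E (absRpow T p).toLinearMap).re ^ (1 / p)

/-- The matrix of `A ⊗ ⋯ ⊗ A` (`k` factors) on `(ℂⁿ)^{⊗k}`, in the orthonormal basis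
`e_{I 0} ⊗ ⋯ ⊗ e_{I (k-1)}` indexed by `I : Fin k → Fin n`. -/
def tensorPower {n : ℕ} (k : ℕ) (A : Matrix (Fin n) (Fin n) ℂ) :
    Matrix (Fin k → Fin n) (Fin k → Fin n) ℂ :=
  Matrix.of fun I J => ∏ j, A (I j) (J j)

/-- The space `∨^k ℂⁿ` of symmetric tensors: the subspace of
`(ℂⁿ)^{⊗k} = EuclideanSpace ℂ (Fin k → Fin n)` of the tensors that are fixed by all
permutations of the `k` factors, with the inherited inner product. -/
def symTensors (n k : ℕ) : Submodule ℂ (EuclideanSpace ℂ (Fin k → Fin n)) where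
  carrier := {x | ∀ (π : Equiv.Perm (Fin k)) (I : Fin k → Fin n), x (I ∘ π) = x I}
  add_mem' := by
    intro x y hx hy π I
    simp [hx π I, hy π I]
  zero_mem' := by
    intro π I
    simp
  smul_mem' := by
    intro c x hx π I
    simp [hx π I]

theorem tensorPower_mem_symTensors {n k : ℕ} (A : Matrix (Fin n) (Fin n) ℂ)
    (x : EuclideanSpace ℂ (Fin k → Fin n)) (hx : x ∈ symTensors n k) :
    Matrix.toEuclideanLin (tensorPower k A) x ∈ symTensors n k := by
  intro π I
  simp only [Matrix.toLpLin_apply, Matrix.mulVec, dotProduct, tensorPower, Matrix.of_apply,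
    Function.comp_apply]
  refine Fintype.sum_equiv (Equiv.arrowCongr π (Equiv.refl (Fin n))) _ _ fun J => ?_
  have h1 : (Equiv.arrowCongr π (Equiv.refl (Fin n))) J = J ∘ π.symm := rfl
  rw [h1, hx π.symm J]
  congr 1
  refine Fintype.prod_equiv π _ _ fun j => ?_
  simp

/-- The symmetric tensor power `∨^k A`: the restriction of `A ⊗ ⋯ ⊗ A` to `∨^k ℂⁿ`. -/
def symPower {n : ℕ} (k : ℕ) (A : Matrix (Fin n) (Fin n) ℂ) :
    symTensors n k →L[ℂ] symTensors n k :=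
  LinearMap.toContinuousLinearMap
    ((Matrix.toEuclideanLin (tensorPower k A)).restrict (tensorPower_mem_symTensors A))

/-- The normalized Euclidean surface measure `σ` on the unit sphere of `ℂⁿ`. -/
def sphereMeasure (n : ℕ) : Measure (Metric.sphere (0 : EuclideanSpace ℂ (Fin n)) 1) :=
  ((volume : Measure (EuclideanSpace ℂ (Fin n))).toSphere Set.univ)⁻¹ •
    (volume : Measure (EuclideanSpace ℂ (Fin n))).toSphere

/-- `N_k^{(p)}(A) = (∫ ⟨|A|^p ξ, ξ⟩^k dσ(ξ))^{1/(pk)}`, the integral being over the unit sphere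
of `ℂⁿ`. The numbers `⟨|A|^p ξ, ξ⟩` are real and nonnegative. -/
def sphereNorm {n : ℕ} (k : ℕ) (p : ℝ) (A : Matrix (Fin n) (Fin n) ℂ) : ℝ :=
  (∫ ξ : Metric.sphere (0 : EuclideanSpace ℂ (Fin n)) 1,
    (inner ℂ (absRpow (Matrix.toEuclideanCLM (𝕜 := ℂ) A) p ξ.1) ξ.1).re ^ k
      ∂(sphereMeasure n)) ^ (1 / (p * k))

/-- Unitarily invariant norms on `M_n(ℂ)`. -/
structure IsUnitarilyInvariantNorm {n : ℕ} (τ : Matrix (Fin n) (Fin n) ℂ → ℝ) : Prop where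
  nonneg : ∀ A, 0 ≤ τ A
  eq_zero_iff : ∀ A, τ A = 0 ↔ A = 0
  smul : ∀ (c : ℂ) (A), τ (c • A) = ‖c‖ * τ A
  add_le : ∀ A B, τ (A + B) ≤ τ A + τ B
  unitary_mul_mul : ∀ A, ∀ U ∈ Matrix.unitaryGroup (Fin n) ℂ,
    ∀ V ∈ Matrix.unitaryGroup (Fin n) ℂ, τ (U * A * V) = τ A

end SymPower

end

/-! Both sides of the identity depend only on the singular values `s` of `A`, and both equal
`h_k(s^p)^{1/(pk)}`, where `h_k` is the complete homogeneous symmetric polynomial.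

On the tensor side, the symmetric power is multiplicative and preserves adjoints, so `|∨^k A|^p =
∨^k(|A|^p)`. The trace of `∨^k` of a diagonal matrix `diag b` is `h_k(b)`.

On the sphere side, a unitary change of variables turns `⟨|A|^p ξ, ξ⟩` into `∑ b_i |ξ_i|²` with `b =
s^p`. The integral of `(∑ b_i |z_i|²)^k e^{-‖z‖²}` over `ℂⁿ` is evaluated twice. Coordinatewise, the
moments `π m!` produce a multiple of `k! h_k(b)`; in polar coordinates it is `(n+k-1)!/2` times the
sphere integral. Comparison with `k = 0` removes the unknown constants and leaves the binomial
coefficient (`choose_mul_integral_sphere`).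

For the norm property, the integral formula exhibits `s ↦ h_k(s^p)^{1/(pk)}` as an `L^{pk}` norm
over the sphere of weighted `ℓ^p` norms, so it is a symmetric gauge function by Minkowski's
inequality (`gauge_add_le`). Von Neumann's argument carries subadditivity to matrices: the singular
values of `A + B` are dominated by a sum of doubly stochastic images of those of `A` and `B`, and
Birkhoff's theorem shows that such images do not increase the gauge (`gauge_mulVec_le`). -/

namespace SymPower

/-! ### Complete homogeneous symmetric polynomials -/

/-- The complete homogeneous symmetric polynomial of degree `k`, as a normalized sum over all
words of length `k`, each weighted by the order of its stabilizer. -/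
noncomputable def completeSymm {n : ℕ} (k : ℕ) (b : Fin n → ℝ) : ℝ :=
  (k.factorial : ℝ)⁻¹ * ∑ I : Fin k → Fin n,
    (Fintype.card {π : Equiv.Perm (Fin k) // I ∘ π = I} : ℝ) * ∏ j, b (I j)

theorem completeSymm_comp_perm {n : ℕ} (k : ℕ) (b : Fin n → ℝ) (e : Equiv.Perm (Fin n)) :
    completeSymm k (b ∘ e) = completeSymm k b := by
  unfold completeSymm
  congr 1
  refine Fintype.sum_equiv (Equiv.arrowCongr (Equiv.refl (Fin k)) e) _ _ fun I => ?_
  have h1 : (Equiv.arrowCongr (Equiv.refl (Fin k)) e) I = e ∘ I := rfl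
  have h2 : ∀ π : Equiv.Perm (Fin k), (e ∘ I) ∘ π = e ∘ I ↔ I ∘ π = I := fun π => by
    rw [Function.comp_assoc, e.injective.comp_left.eq_iff]
  rw [h1]
  simp only [h2, Function.comp_apply]

theorem completeSymm_nonneg {n : ℕ} (k : ℕ) {b : Fin n → ℝ} (hb : ∀ i, 0 ≤ b i) :
    0 ≤ completeSymm k b :=
  mul_nonneg (by positivity) (Finset.sum_nonneg fun I _ =>
    mul_nonneg (by positivity) (Finset.prod_nonneg fun j _ => hb _))

theorem completeSymm_smul {n : ℕ} (k : ℕ) (c : ℝ) (b : Fin n → ℝ) :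
    completeSymm k (fun i => c * b i) = c ^ k * completeSymm k b := by
  simp only [completeSymm, Finset.prod_mul_distrib, Finset.prod_const, Finset.card_univ,
    Fintype.card_fin, Finset.mul_sum]
  exact Finset.sum_congr rfl fun I _ => by ring

/-- A constant word is fixed by all `k!` permutations, so its term is exactly `b i ^ k`, and the
other terms are nonnegative. This gives definiteness of the norm. -/
theorem pow_le_completeSymm {n : ℕ} (k : ℕ) {b : Fin n → ℝ} (hb : ∀ i, 0 ≤ b i) (i : Fin n) :
    b i ^ k ≤ completeSymm k b := by
  have h := Finset.single_le_sum (s := Finset.univ)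
    (f := fun I : Fin k → Fin n =>
      (Fintype.card {π : Equiv.Perm (Fin k) // I ∘ π = I} : ℝ) * ∏ j, b (I j))
    (fun I _ => mul_nonneg (by positivity) (Finset.prod_nonneg fun j _ => hb _))
    (Finset.mem_univ fun _ => i)
  have h2 : Fintype.card {π : Equiv.Perm (Fin k) // (fun _ : Fin k => i) ∘ π = fun _ => i} =
      k.factorial := by
    rw [Fintype.card_of_subtype Finset.univ (by intro π; simp; rfl)]
    simp [Fintype.card_perm]
  simp only [h2, Finset.prod_const, Finset.card_univ, Fintype.card_fin] at h
  unfold completeSymm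
  rw [le_inv_mul_iff₀ (by positivity)]
  exact h

/-! ### Gaussian moments on `ℂⁿ` -/

section Gaussian

theorem integral_norm_pow_mul_exp (m : ℕ) :
    ∫ z : ℂ, (‖z‖ ^ 2) ^ m * Real.exp (-‖z‖ ^ 2) = Real.pi * m.factorial := by
  have h := Complex.integral_rpow_mul_exp_neg_rpow (p := 2) (q := ((2 * m : ℕ) : ℝ))
    (by norm_num) (by have : (0 : ℝ) ≤ ((2 * m : ℕ) : ℝ) := by positivity
                      linarith)
  have e : ((((2 * m : ℕ) : ℝ)) + 2) / 2 = (m : ℝ) + 1 := by push_cast; ring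
  rw [e, Real.Gamma_nat_eq_factorial] at h
  simp only [Real.rpow_natCast, Real.rpow_ofNat, pow_mul] at h
  rw [h]
  ring

theorem integrable_norm_pow_mul_exp (m : ℕ) :
    Integrable fun z : ℂ => (‖z‖ ^ 2) ^ m * Real.exp (-‖z‖ ^ 2) := by
  -- A non-integrable function would have integral `0` by convention, but the value just computed is
  -- positive.
  by_contra h
  have h1 := integral_norm_pow_mul_exp m
  rw [integral_undef h] at h1
  have : 0 < Real.pi * (m.factorial : ℝ) := by positivity
  linarith

variable {n : ℕ}

theorem norm_sq_pow_prod_mul_exp (k : ℕ) (I : Fin k → Fin n) (z : EuclideanSpace ℂ (Fin n)) :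
    (∏ j, ‖z (I j)‖ ^ 2) * Real.exp (-‖z‖ ^ 2) =
      ∏ i, ((‖z i‖ ^ 2) ^ Fintype.card {j // I j = i} * Real.exp (-‖z i‖ ^ 2)) := by
  rw [Finset.prod_mul_distrib, ← Real.exp_sum, EuclideanSpace.norm_sq_eq,
    Finset.sum_neg_distrib, Finset.prod_comp (fun i => ‖z i‖ ^ 2) I]
  congr 1
  rw [← Finset.prod_subset (Finset.subset_univ (Finset.univ.image I))]
  · exact Finset.prod_congr rfl fun i _ => by rw [Fintype.card_subtype]
  · intro i _ hi
    have : Fintype.card {j // I j = i} = 0 := by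
      rw [Fintype.card_eq_zero_iff]
      exact ⟨fun j => hi (Finset.mem_image.2 ⟨j.1, Finset.mem_univ _, j.2⟩)⟩
    rw [this, pow_zero]

/-- Lebesgue measure on `EuclideanSpace ℂ (Fin n)` is, up to a constant, the product measure. -/
theorem exists_map_ofLp_volume (n : ℕ) : ∃ c : NNReal, c ≠ 0 ∧
    (volume : Measure (EuclideanSpace ℂ (Fin n))).map WithLp.ofLp =
      c • (volume : Measure (Fin n → ℂ)) := by
  let e : EuclideanSpace ℂ (Fin n) ≃L[ℝ] (Fin n → ℂ) :=
    PiLp.continuousLinearEquiv 2 ℝ (fun _ : Fin n => ℂ)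
  have : ((volume : Measure (EuclideanSpace ℂ (Fin n))).map WithLp.ofLp).IsAddHaarMeasure :=
    e.isAddHaarMeasure_map _
  refine ⟨_, ?_, Measure.isAddLeftInvariant_eq_smul _ _⟩
  exact (Measure.addHaarScalarFactor_pos_of_isAddHaarMeasure _ _).ne'

theorem measurableEmbedding_ofLp (n : ℕ) :
    MeasurableEmbedding (WithLp.ofLp : EuclideanSpace ℂ (Fin n) → Fin n → ℂ) :=
  (PiLp.continuousLinearEquiv 2 ℝ (fun _ : Fin n => ℂ)).toHomeomorph.measurableEmbedding

theorem integral_gaussian_prod_aux (n : ℕ) : ∃ c : ℝ, 0 < c ∧ ∀ g : Fin n → ℂ → ℝ,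
    ∫ z : EuclideanSpace ℂ (Fin n), ∏ i, g i (z i) = c * ∏ i, ∫ z : ℂ, g i z := by
  obtain ⟨c, hc, h⟩ := exists_map_ofLp_volume n
  refine ⟨c, by positivity, fun g => ?_⟩
  have h1 := (measurableEmbedding_ofLp n).integral_map (μ := volume)
    (fun z : Fin n → ℂ => ∏ i, g i (z i))
  rw [h] at h1
  rw [← h1, integral_smul_nnreal_measure, integral_fintype_prod_volume_eq_prod]
  rfl

theorem integrable_gaussian_prod (k : ℕ) (I : Fin k → Fin n) :
    Integrable fun z : EuclideanSpace ℂ (Fin n) =>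
      (∏ j, ‖z (I j)‖ ^ 2) * Real.exp (-‖z‖ ^ 2) := by
  obtain ⟨c, hc, h⟩ := exists_map_ofLp_volume n
  simp only [norm_sq_pow_prod_mul_exp]
  have h1 : Integrable (fun z : Fin n → ℂ => ∏ i, ((‖z i‖ ^ 2) ^ Fintype.card {j // I j = i} *
      Real.exp (-‖z i‖ ^ 2))) (c • volume) :=
    (Integrable.fintype_prod fun i => integrable_norm_pow_mul_exp
      (Fintype.card {j // I j = i})).smul_measure_nnreal
  rw [← h, (measurableEmbedding_ofLp n).integrable_map_iff] at h1
  exact h1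

/-- Expanding the power gives a sum over words `I`; the moment of `I` is a constant times `∏ m_i!`,
with `m_i` the multiplicity of the letter `i`, and this product is the order of the stabilizer of
`I`. The constant `c` must not depend on `k`, so that `k = 0` can eliminate it later. -/
theorem integral_gaussian_sum_pow (n : ℕ) : ∃ c : ℝ, 0 < c ∧ ∀ (k : ℕ) (b : Fin n → ℝ),
    ∫ z : EuclideanSpace ℂ (Fin n), (∑ i, b i * ‖z i‖ ^ 2) ^ k * Real.exp (-‖z‖ ^ 2) =
      c * (k.factorial * completeSymm k b) := by
  obtain ⟨c, hc, h⟩ := integral_gaussian_prod_aux n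
  refine ⟨c * Real.pi ^ n, by positivity, fun k b => ?_⟩
  have h1 : ∀ z : EuclideanSpace ℂ (Fin n),
      (∑ i, b i * ‖z i‖ ^ 2) ^ k * Real.exp (-‖z‖ ^ 2) =
      ∑ I : Fin k → Fin n, (∏ j, b (I j)) * ((∏ j, ‖z (I j)‖ ^ 2) * Real.exp (-‖z‖ ^ 2)) := by
    intro z
    have := Finset.prod_univ_sum (fun _ : Fin k => (Finset.univ : Finset (Fin n)))
      (fun _ i => b i * ‖z i‖ ^ 2)
    simp only [Finset.prod_const, Finset.card_univ, Fintype.card_fin,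
      Fintype.piFinset_univ] at this
    rw [this, Finset.sum_mul]
    exact Finset.sum_congr rfl fun I _ => by rw [Finset.prod_mul_distrib]; ring
  simp only [h1]
  rw [integral_finsetSum _ fun I _ => (integrable_gaussian_prod k I).const_mul _]
  unfold completeSymm
  rw [mul_inv_cancel_left₀ (by positivity), Finset.mul_sum]
  refine Finset.sum_congr rfl fun I _ => ?_
  rw [integral_const_mul]
  simp only [norm_sq_pow_prod_mul_exp]
  rw [h fun i z => (‖z‖ ^ 2) ^ Fintype.card {j // I j = i} * Real.exp (-‖z‖ ^ 2)]
  simp only [integral_norm_pow_mul_exp]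
  rw [Finset.prod_mul_distrib, DomMulAct.stabilizer_card]
  simp only [Finset.prod_const, Finset.card_univ, Fintype.card_fin]
  push_cast
  ring

theorem integral_gaussian_comp_isometry
    (Φ : EuclideanSpace ℂ (Fin n) ≃ₗᵢ[ℂ] EuclideanSpace ℂ (Fin n))
    (f : EuclideanSpace ℂ (Fin n) → ℝ) :
    ∫ z, f (Φ z) * Real.exp (-‖z‖ ^ 2) = ∫ z, f z * Real.exp (-‖z‖ ^ 2) := by
  let Ψ : EuclideanSpace ℂ (Fin n) ≃ₗᵢ[ℝ] EuclideanSpace ℂ (Fin n) :=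
    ⟨Φ.toLinearEquiv.restrictScalars ℝ, Φ.norm_map⟩
  have h := Ψ.measurePreserving.integral_comp Ψ.toHomeomorph.measurableEmbedding
    fun z => f z * Real.exp (-‖z‖ ^ 2)
  rw [← h]
  refine integral_congr_ae (Filter.Eventually.of_forall fun z => ?_)
  change f (Φ z) * _ = f (Φ z) * Real.exp (-‖Φ z‖ ^ 2)
  rw [Φ.norm_map]

end Gaussian

/-! ### Polar coordinates -/

section Polar

theorem integral_radial_mul_exp (n k : ℕ) (hn : 0 < n) :
    ∫ y in Set.Ioi (0 : ℝ), y ^ (2 * n - 1) * (y ^ (2 * k) * Real.exp (-y ^ 2)) =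
      (n + k - 1).factorial / 2 := by
  have h := integral_rpow_mul_exp_neg_rpow (p := 2) (q := ((2 * (n + k) - 1 : ℕ) : ℝ))
    (by norm_num) (by have : (0 : ℝ) ≤ ((2 * (n + k) - 1 : ℕ) : ℝ) := by positivity
                      linarith)
  have e : ((((2 * (n + k) - 1 : ℕ) : ℝ)) + 1) / 2 = ((n + k - 1 : ℕ) : ℝ) + 1 := by
    rw [Nat.cast_sub (by omega), Nat.cast_sub (by omega)]; push_cast; ring
  rw [e, Real.Gamma_nat_eq_factorial] at h
  simp only [Real.rpow_natCast, Real.rpow_ofNat] at h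
  have e2 : 2 * (n + k) - 1 = (2 * n - 1) + 2 * k := by omega
  rw [e2] at h
  simp only [← mul_assoc, ← pow_add]
  rw [h]
  ring

variable {E : Type*} [NormedAddCommGroup E] [NormedSpace ℝ E] [MeasurableSpace E]
  [BorelSpace E] [FiniteDimensional ℝ E]

/-- Homogeneity separates `f` into its restriction to the sphere and `r^(2k)`; the radial integral
against `r^(2n-1) dr` is `Γ(n+k)/2`. -/
theorem integral_homogeneous_mul_exp (μ : Measure E) [μ.IsAddHaarMeasure] (n k : ℕ) (hn : 0 < n)
    (hE : Module.finrank ℝ E = 2 * n) (f : E → ℝ)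
    (hf : ∀ (r : ℝ) (x : E), f (r • x) = r ^ (2 * k) * f x) :
    ∫ x, f x * Real.exp (-‖x‖ ^ 2) ∂μ =
      (n + k - 1).factorial / 2 * ∫ ξ : Metric.sphere (0 : E) 1, f ξ ∂μ.toSphere := by
  have : Nontrivial E := Module.nontrivial_of_finrank_pos (R := ℝ) (by omega)
  have h0 : ∀ x : ({(0 : E)}ᶜ : Set E), f x * Real.exp (-‖x.1‖ ^ 2) =
      f (homeomorphUnitSphereProd E x).1 * ((homeomorphUnitSphereProd E x).2.1 ^ (2 * k) *
        Real.exp (-(homeomorphUnitSphereProd E x).2.1 ^ 2)) := by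
    intro x
    have hx : ‖x.1‖ ≠ 0 := norm_ne_zero_iff.2 x.2
    simp only [homeomorphUnitSphereProd_apply_fst_coe, homeomorphUnitSphereProd_apply_snd_coe, hf]
    have h1 : ‖x.1‖⁻¹ ^ (2 * k) * ‖x.1‖ ^ (2 * k) = 1 := by
      rw [← mul_pow, inv_mul_cancel₀ hx, one_pow]
    linear_combination -(f x.1 * Real.exp (-‖x.1‖ ^ 2)) * h1
  calc ∫ x, f x * Real.exp (-‖x‖ ^ 2) ∂μ
      = ∫ x : ({(0 : E)}ᶜ : Set E), f x * Real.exp (-‖x.1‖ ^ 2) ∂(μ.comap (↑)) := by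
        rw [integral_subtype_comap (measurableSet_singleton _).compl
          fun x => f x * Real.exp (-‖x‖ ^ 2), restrict_compl_singleton]
    _ = ∫ x, f x.1 * (x.2.1 ^ (2 * k) * Real.exp (-x.2.1 ^ 2))
          ∂μ.toSphere.prod (.volumeIoiPow (Module.finrank ℝ E - 1)) := by
        simp only [h0]
        exact μ.measurePreserving_homeomorphUnitSphereProd.integral_comp
          (Homeomorph.measurableEmbedding _)
          (fun x => f x.1 * (x.2.1 ^ (2 * k) * Real.exp (-x.2.1 ^ 2)))
    _ = (∫ ξ : Metric.sphere (0 : E) 1, f ξ ∂μ.toSphere) *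
          ∫ y : Set.Ioi (0 : ℝ), y.1 ^ (2 * k) * Real.exp (-y.1 ^ 2)
            ∂.volumeIoiPow (Module.finrank ℝ E - 1) :=
        integral_prod_mul (fun ξ : Metric.sphere (0 : E) 1 => f ξ)
          (fun y : Set.Ioi (0 : ℝ) => y.1 ^ (2 * k) * Real.exp (-y.1 ^ 2))
    _ = _ := by
        rw [mul_comm, ← integral_radial_mul_exp n k hn, hE]
        congr 1
        simp only [Measure.volumeIoiPow, ENNReal.ofReal]
        rw [integral_withDensity_eq_integral_smul
            (measurable_subtype_coe.pow_const _).real_toNNReal,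
          integral_subtype_comap measurableSet_Ioi fun a : ℝ =>
            Real.toNNReal (a ^ (2 * n - 1)) • (a ^ (2 * k) * Real.exp (-a ^ 2))]
        refine setIntegral_congr_fun measurableSet_Ioi fun x hx => ?_
        simp only [NNReal.smul_def, smul_eq_mul]
        rw [Real.coe_toNNReal _ (pow_nonneg hx.out.le _)]

end Polar

/-! ### Averages over the normalized sphere -/

theorem finrank_real_euclideanSpace_complex (n : ℕ) :
    Module.finrank ℝ (EuclideanSpace ℂ (Fin n)) = 2 * n := by
  have := finrank_real_of_complex (EuclideanSpace ℂ (Fin n))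
  rw [finrank_euclideanSpace_fin] at this
  convert this

instance isFiniteMeasure_sphereMeasure (n : ℕ) : IsFiniteMeasure (sphereMeasure n) := by
  unfold sphereMeasure
  -- For `n = 0` the sphere is empty: the scalar is `∞`, but it multiplies the zero measure.
  by_cases h : (volume : Measure (EuclideanSpace ℂ (Fin n))).toSphere Set.univ = 0
  · rw [Measure.measure_univ_eq_zero.1 h]
    simp only [smul_zero]
    infer_instance
  · exact Measure.smul_finite _ (ENNReal.inv_ne_top.2 h)

theorem choose_mul_integral_sphere (n k : ℕ) (hn : 0 < n) (b : Fin n → ℝ)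
    (Φ : EuclideanSpace ℂ (Fin n) ≃ₗᵢ[ℂ] EuclideanSpace ℂ (Fin n)) :
    ((n + k - 1).choose k : ℝ) * ∫ ξ : Metric.sphere (0 : EuclideanSpace ℂ (Fin n)) 1,
      (∑ i, b i * ‖Φ ξ.1 i‖ ^ 2) ^ k ∂sphereMeasure n = completeSymm k b := by
  obtain ⟨c, hc, h⟩ := integral_gaussian_sum_pow n
  have hk := integral_homogeneous_mul_exp (volume : Measure (EuclideanSpace ℂ (Fin n))) n k hn
    (finrank_real_euclideanSpace_complex n) (fun x => (∑ i, b i * ‖Φ x i‖ ^ 2) ^ k) (by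
      intro r x
      have hr : Φ (r • x) = r • Φ x := (Φ.toLinearEquiv.toLinearMap.restrictScalars ℝ).map_smul r x
      simp only [hr, PiLp.smul_apply, norm_smul, mul_pow, Real.norm_eq_abs, sq_abs]
      rw [pow_mul, ← mul_pow, Finset.mul_sum]
      exact congrArg (· ^ k) (Finset.sum_congr rfl fun i _ => by ring))
  -- The case `k = 0` expresses the Gaussian constant `c` through the total mass of the sphere.
  have h0 := integral_homogeneous_mul_exp (volume : Measure (EuclideanSpace ℂ (Fin n))) n 0 hn
    (finrank_real_euclideanSpace_complex n) (fun _ => 1) (by simp)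
  have h0' := h 0 b
  rw [integral_gaussian_comp_isometry Φ fun z => (∑ i, b i * ‖z i‖ ^ 2) ^ k, h] at hk
  simp only [pow_zero] at h0'
  rw [h0] at h0'
  have hc0 : completeSymm 0 b = 1 := by
    simp [completeSymm, Fintype.card_subtype, Subsingleton.elim _ (default : Fin 0 → Fin n)]
  simp only [hc0, integral_const, smul_eq_mul, mul_one, add_zero, Nat.factorial_zero,
    Nat.cast_one] at h0'
  have hs : (volume : Measure (EuclideanSpace ℂ (Fin n))).toSphere.real Set.univ ≠ 0 := by
    intro hz
    rw [hz] at h0'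
    simp at h0'
    exact hc.ne' h0'.symm
  unfold sphereMeasure
  rw [integral_smul_measure, ENNReal.toReal_inv, smul_eq_mul]
  change _ * (((volume : Measure (EuclideanSpace ℂ (Fin n))).toSphere.real Set.univ)⁻¹ * _) = _
  have hch : ((n + k - 1).choose k : ℝ) * (k.factorial * (n - 1).factorial) =
      (n + k - 1).factorial := by
    have := Nat.choose_mul_factorial_mul_factorial (n := n + k - 1) (k := k) (by omega)
    rw [show n + k - 1 - k = n - 1 by omega] at this
    rw [← this]
    push_cast
    ring
  have hkf : (k.factorial : ℝ) ≠ 0 := by positivity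
  have hnf : ((n - 1).factorial : ℝ) ≠ 0 := by positivity
  set S := (volume : Measure (EuclideanSpace ℂ (Fin n))).toSphere.real Set.univ
  set J := ∫ ξ : Metric.sphere (0 : EuclideanSpace ℂ (Fin n)) 1,
      (∑ i, b i * ‖Φ ξ.1 i‖ ^ 2) ^ k ∂(volume : Measure (EuclideanSpace ℂ (Fin n))).toSphere
  rw [← hch, ← h0'] at hk
  have h3 : (k.factorial * (n - 1).factorial / 2 : ℝ) * (S * completeSymm k b) =
      (k.factorial * (n - 1).factorial / 2 : ℝ) * (((n + k - 1).choose k : ℝ) * J) := by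
    linear_combination hk
  have h4 := mul_left_cancel₀ (by positivity) h3
  rw [← mul_assoc, mul_comm _ S⁻¹, mul_assoc, ← h4, inv_mul_cancel_left₀ hs]

/-! ### Functional calculus on eigenvectors -/

section FunctionalCalculus

variable {E : Type*} [NormedAddCommGroup E] [InnerProductSpace ℂ E]

theorem finite_spectrum_real [FiniteDimensional ℂ E] (a : E →L[ℂ] E) : (spectrum ℝ a).Finite := by
  rw [← spectrum.preimage_algebraMap ℂ]
  refine Set.Finite.preimage (FaithfulSMul.algebraMap_injective ℝ ℂ).injOn ?_
  rw [← AlgEquiv.spectrum_eq (Module.End.toContinuousLinearMap (𝕜 := ℂ) E).symm a]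
  exact Module.End.finite_spectrum _

theorem aeval_apply_eigenvector (a : E →L[ℂ] E) (v : E) (lam : ℝ) (h : a v = (lam : ℂ) • v)
    (q : Polynomial ℝ) : Polynomial.aeval a q v = ((q.eval lam : ℝ) : ℂ) • v := by
  induction q using Polynomial.induction_on' with
  | add q r hq hr => simp [hq, hr, add_smul]
  | monomial m c =>
    have hm : (a ^ m) v = ((lam : ℂ) ^ m) • v := by
      induction m with
      | zero => simp
      | succ m ih => rw [pow_succ, mul_apply_eq_comp, h, map_smul, ih, smul_smul,
          pow_succ, mul_comm]
    rw [Polynomial.aeval_monomial, Polynomial.eval_monomial, mul_apply_eq_comp, hm,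
      map_smul, Algebra.algebraMap_eq_smul_one]
    simp only [_root_.smul_apply, one_apply_eq_self]
    rw [← Complex.coe_smul, smul_smul]
    push_cast
    rw [mul_comm]

variable [FiniteDimensional ℂ E] [CompleteSpace E]

theorem cfc_apply_eigenvector (a : E →L[ℂ] E) (ha : IsSelfAdjoint a) (f : ℝ → ℝ) (v : E)
    (lam : ℝ) (h : a v = (lam : ℂ) • v) : cfc f a v = ((f lam : ℝ) : ℂ) • v := by
  classical
  -- Interpolating `f` on the finite spectrum reduces to polynomials. Inserting `lam` as a node
  -- avoids deciding whether it lies in the spectrum, since `v` may be zero.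
  let s : Finset ℝ := insert lam (finite_spectrum_real a).toFinset
  let q : Polynomial ℝ := Lagrange.interpolate s id f
  have hq : ∀ x ∈ s, q.eval x = f x := fun x hx =>
    Lagrange.eval_interpolate_at_node (v := id) f (Function.injective_id.injOn) hx
  have h1 : cfc f a = Polynomial.aeval a q := by
    rw [← cfc_polynomial q a]
    refine cfc_congr fun x hx => (hq x ?_).symm
    simp [s, hx]
  rw [h1, aeval_apply_eigenvector a v lam h, hq lam (by simp [s])]

/-- `|T|^p` is determined by its action on a spanning family of eigenvectors of `T* T`. -/
theorem absRpow_eq_of_eigenvectors {ι : Type*} (T S : E →L[ℂ] E) (p : ℝ) (hp : 0 ≤ p)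
    (v : ι → E) (hv : Submodule.span ℂ (Set.range v) = ⊤) (s : ι → ℝ) (hs : ∀ i, 0 ≤ s i)
    (hT : ∀ i, (star T * T) (v i) = ((s i ^ 2 : ℝ) : ℂ) • v i)
    (hS : ∀ i, S (v i) = ((s i ^ p : ℝ) : ℂ) • v i) : absRpow T p = S := by
  have h0 : 0 ≤ star T * T := star_mul_self_nonneg T
  have h1 : absRpow T p = cfc (fun x : ℝ => x ^ (1 / 2 * p)) (star T * T) := by
    rw [← CFC.rpow_eq_cfc_real h0,
      ← CFC.rpow_rpow_of_exponent_nonneg _ _ _ (by norm_num) hp h0, ← CFC.sqrt_eq_rpow]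
    rfl
  rw [h1]
  apply ContinuousLinearMap.coe_injective
  refine LinearMap.ext_on_range hv fun i => ?_
  change cfc (fun x : ℝ => x ^ (1 / 2 * p)) (star T * T) (v i) = S (v i)
  rw [cfc_apply_eigenvector _ h0.isSelfAdjoint _ _ _ (hT i), hS, ← Real.rpow_natCast,
    ← Real.rpow_mul (hs i)]
  congr 3
  push_cast
  ring

end FunctionalCalculus

/-! ### Symmetric powers: functoriality, eigenvectors, trace -/

section Algebra

variable {n : ℕ} (k : ℕ)

theorem tensorPower_mul (A B : Matrix (Fin n) (Fin n) ℂ) :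
    tensorPower k (A * B) = tensorPower k A * tensorPower k B := by
  ext I J
  have := Finset.prod_univ_sum (fun _ : Fin k => (Finset.univ : Finset (Fin n)))
    (fun j i => A (I j) i * B i (J j))
  simp only [Fintype.piFinset_univ] at this
  simp only [tensorPower, Matrix.mul_apply, Matrix.of_apply, this, Finset.prod_mul_distrib]

theorem tensorPower_conjTranspose (A : Matrix (Fin n) (Fin n) ℂ) :
    tensorPower k A.conjTranspose = (tensorPower k A).conjTranspose := by
  ext I J
  simp [tensorPower, Matrix.conjTranspose_apply]

theorem tensorPower_diagonal (b : Fin n → ℂ) :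
    tensorPower k (Matrix.diagonal b) = Matrix.diagonal fun I => ∏ j, b (I j) := by
  ext I J
  by_cases h : I = J
  · subst h; simp [tensorPower]
  · obtain ⟨j, hj⟩ := Function.ne_iff.1 h
    rw [Matrix.diagonal_apply_ne _ h]
    simp only [tensorPower, Matrix.of_apply]
    exact Finset.prod_eq_zero (Finset.mem_univ j) (Matrix.diagonal_apply_ne _ hj)

/-- The operators on an inner product space, with the topology coming from the norm. -/
abbrev HilbertOp (E : Type*) [NormedAddCommGroup E] [InnerProductSpace ℂ E] := E →L[ℂ] E

/-- `symPower`, as an element of the star algebra of operators on the symmetric tensors. -/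
noncomputable def symPowerOp (A : Matrix (Fin n) (Fin n) ℂ) : HilbertOp (symTensors n k) :=
  symPower k A

theorem coe_symPower_apply (A : Matrix (Fin n) (Fin n) ℂ) (x : symTensors n k) :
    (symPowerOp k A x : EuclideanSpace ℂ (Fin k → Fin n)) =
      Matrix.toEuclideanLin (tensorPower k A) x := rfl

theorem symPower_mul (A B : Matrix (Fin n) (Fin n) ℂ) :
    symPowerOp k (A * B) = symPowerOp k A * symPowerOp k B := by
  ext1 x
  apply Subtype.ext
  rw [mul_apply_eq_comp, coe_symPower_apply, coe_symPower_apply, coe_symPower_apply,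
    tensorPower_mul, Matrix.toLpLin_mul_same]
  rfl

theorem symPower_one : symPowerOp k (1 : Matrix (Fin n) (Fin n) ℂ) = 1 := by
  ext1 x
  apply Subtype.ext
  rw [coe_symPower_apply, ← Matrix.diagonal_one, tensorPower_diagonal]
  simp

theorem symPower_conjTranspose (A : Matrix (Fin n) (Fin n) ℂ) :
    symPowerOp k A.conjTranspose = star (symPowerOp k A) := by
  rw [ContinuousLinearMap.star_eq_adjoint, ContinuousLinearMap.eq_adjoint_iff]
  intro x y
  rw [Submodule.coe_inner, Submodule.coe_inner, coe_symPower_apply, coe_symPower_apply,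
    tensorPower_conjTranspose, Matrix.toEuclideanLin_conjTranspose_eq_adjoint,
    LinearMap.adjoint_inner_left]

/-- The matrix of the orthogonal projection onto the symmetric tensors. -/
noncomputable def symProj (n k : ℕ) : Matrix (Fin k → Fin n) (Fin k → Fin n) ℂ :=
  Matrix.of fun I J =>
    (k.factorial : ℂ)⁻¹ * (Fintype.card {π : Equiv.Perm (Fin k) // I ∘ π = J} : ℂ)

theorem toEuclideanLin_symProj_mem (x : EuclideanSpace ℂ (Fin k → Fin n)) :
    Matrix.toEuclideanLin (symProj n k) x ∈ symTensors n k := by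
  intro σ I
  simp only [Matrix.toLpLin_apply, Matrix.mulVec, dotProduct, symProj, Matrix.of_apply]
  refine Finset.sum_congr rfl fun J _ => ?_
  congr 3
  exact Fintype.card_congr ((Equiv.mulLeft σ).subtypeEquiv fun π => Iff.rfl)

theorem toEuclideanLin_symProj_eq_self (x : EuclideanSpace ℂ (Fin k → Fin n))
    (hx : x ∈ symTensors n k) : Matrix.toEuclideanLin (symProj n k) x = x := by
  ext I
  simp only [Matrix.toLpLin_apply, Matrix.mulVec, dotProduct, symProj, Matrix.of_apply, mul_assoc]
  rw [← Finset.mul_sum, inv_mul_eq_iff_eq_mul₀ (by exact_mod_cast k.factorial_ne_zero)]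
  have h : ∀ J : Fin k → Fin n,
      (Fintype.card {π : Equiv.Perm (Fin k) // I ∘ π = J} : ℂ) * x J =
        ∑ π : Equiv.Perm (Fin k), if I ∘ π = J then x J else 0 := fun J => by
    rw [Fintype.card_subtype, ← Finset.sum_filter, Finset.sum_const, nsmul_eq_mul]
  simp only [h]
  rw [Finset.sum_comm]
  simp only [Finset.sum_ite_eq, Finset.mem_univ, if_true]
  simp only [fun π => hx π I, Finset.sum_const, Finset.card_univ, Fintype.card_perm,
    Fintype.card_fin, nsmul_eq_mul]

/-- The symmetrization of a basis tensor. -/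
noncomputable def symBasisVec (J : Fin k → Fin n) : symTensors n k :=
  ⟨Matrix.toEuclideanLin (symProj n k) (EuclideanSpace.single J 1),
    toEuclideanLin_symProj_mem k _⟩

theorem symBasisVec_apply (J I : Fin k → Fin n) :
    (symBasisVec k J : EuclideanSpace ℂ (Fin k → Fin n)) I = symProj n k I J := by
  simp [symBasisVec, Matrix.toLpLin_apply]

theorem span_symBasisVec :
    Submodule.span ℂ (Set.range (symBasisVec (n := n) k)) = ⊤ := by
  refine eq_top_iff.2 fun x _ => ?_
  have hx : x = ∑ J, (x : EuclideanSpace ℂ (Fin k → Fin n)) J • symBasisVec k J := by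
    apply Subtype.ext
    conv_lhs => rw [← toEuclideanLin_symProj_eq_self k (x : EuclideanSpace ℂ (Fin k → Fin n)) x.2]
    ext I
    simp only [Submodule.coe_sum, Submodule.coe_smul, WithLp.ofLp_sum, Finset.sum_apply,
      PiLp.smul_apply, symBasisVec_apply, smul_eq_mul]
    simp [Matrix.toLpLin_apply, Matrix.mulVec, dotProduct, mul_comm]
  rw [hx]
  exact Submodule.sum_mem _ fun J _ =>
    Submodule.smul_mem _ _ (Submodule.subset_span ⟨J, rfl⟩)

/-- The symmetrized tensor is supported on the permutation orbit of `J`, where the product of the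
`b` values is constant. -/
theorem symPower_diagonal_symBasisVec (b : Fin n → ℂ) (J : Fin k → Fin n) :
    symPowerOp k (Matrix.diagonal b) (symBasisVec k J) = (∏ j, b (J j)) • symBasisVec k J := by
  apply Subtype.ext
  ext I
  rw [coe_symPower_apply, tensorPower_diagonal]
  simp only [Matrix.toLpLin_apply, Matrix.mulVec_diagonal, Submodule.coe_smul, PiLp.smul_apply,
    symBasisVec_apply, smul_eq_mul]
  by_cases h : ∃ π : Equiv.Perm (Fin k), I ∘ π = J
  · obtain ⟨π, rfl⟩ := h
    congr 1
    exact (Equiv.prod_comp π fun j => b (I j)).symm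
  · have : symProj n k I J = 0 := by
      have : IsEmpty {π : Equiv.Perm (Fin k) // I ∘ π = J} := ⟨fun π => h ⟨π.1, π.2⟩⟩
      simp [symProj]
    simp [this]

/-- No basis of the symmetric tensors is needed: composing with the symmetrizer gives an operator on
the whole tensor space with range in the subspace, whose trace is unchanged by restriction. The
diagonal entries of the symmetrizer are the stabilizer orders over `k!`. -/
theorem trace_symPower_diagonal (b : Fin n → ℝ) :
    LinearMap.trace ℂ (symTensors n k)
      (symPowerOp k (Matrix.diagonal fun i => (b i : ℂ))).toLinearMap = (completeSymm k b : ℂ) := by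
  set D : Matrix (Fin n) (Fin n) ℂ := Matrix.diagonal fun i => (b i : ℂ) with hD
  let F : Module.End ℂ (EuclideanSpace ℂ (Fin k → Fin n)) :=
    Matrix.toEuclideanLin (tensorPower k D * symProj n k)
  have hF : ∀ x, F x ∈ symTensors n k := fun x => by
    simp only [F, Matrix.toLpLin_mul_same, LinearMap.comp_apply]
    exact tensorPower_mem_symTensors _ _ (toEuclideanLin_symProj_mem k x)
  have h1 : (symPowerOp k D).toLinearMap = F.restrict fun x _ => hF x := by
    ext1 x
    apply Subtype.ext
    rw [LinearMap.coe_restrict_apply]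
    simp only [F, Matrix.toLpLin_mul_same, LinearMap.comp_apply]
    rw [toEuclideanLin_symProj_eq_self k (x : EuclideanSpace ℂ (Fin k → Fin n)) x.2]
    rfl
  rw [h1, LinearMap.trace_restrict_eq_of_forall_mem _ _ hF]
  simp only [F]
  rw [Matrix.toEuclideanLin_eq_toLin_orthonormal, Matrix.trace_toLin_eq, hD, tensorPower_diagonal,
    completeSymm]
  simp only [Matrix.trace, Matrix.diag, Matrix.diagonal_mul, symProj, Matrix.of_apply]
  push_cast
  rw [Finset.mul_sum]
  exact Finset.sum_congr rfl fun I _ => by ring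

end Algebra

/-! ### Both sides in terms of singular values -/

section SingularValues

variable {n : ℕ}

/-- `A = X diag(s) Y*` is a singular value decomposition. -/
structure IsSVD (A X Y : Matrix (Fin n) (Fin n) ℂ) (s : Fin n → ℝ) : Prop where
  left_mem : X ∈ Matrix.unitaryGroup (Fin n) ℂ
  right_mem : Y ∈ Matrix.unitaryGroup (Fin n) ℂ
  nonneg : ∀ i, 0 ≤ s i
  eq : A = X * Matrix.diagonal (fun i => (s i : ℂ)) * Y.conjTranspose

theorem conjTranspose_mul_self_of_mem {U : Matrix (Fin n) (Fin n) ℂ}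
    (hU : U ∈ Matrix.unitaryGroup (Fin n) ℂ) : U.conjTranspose * U = 1 :=
  Matrix.mem_unitaryGroup_iff'.1 hU

theorem mul_conjTranspose_self_of_mem {U : Matrix (Fin n) (Fin n) ℂ}
    (hU : U ∈ Matrix.unitaryGroup (Fin n) ℂ) : U * U.conjTranspose = 1 :=
  Matrix.mem_unitaryGroup_iff.1 hU

theorem IsSVD.conjTranspose_mul_self {A X Y : Matrix (Fin n) (Fin n) ℂ} {s : Fin n → ℝ}
    (h : IsSVD A X Y s) : A.conjTranspose * A =
      Y * Matrix.diagonal (fun i => ((s i ^ 2 : ℝ) : ℂ)) * Y.conjTranspose := by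
  have hd : (Matrix.diagonal (fun i => (s i : ℂ))).conjTranspose =
      Matrix.diagonal (fun i => (s i : ℂ)) := by
    rw [Matrix.diagonal_conjTranspose]
    congr 1
    ext i
    simp
  have h2 : Matrix.diagonal (fun i => (s i : ℂ)) * Matrix.diagonal (fun i => (s i : ℂ)) =
      Matrix.diagonal (fun i => ((s i ^ 2 : ℝ) : ℂ)) := by
    rw [Matrix.diagonal_mul_diagonal]
    congr 1
    ext i
    push_cast
    ring
  rw [h.eq, Matrix.conjTranspose_mul, Matrix.conjTranspose_mul, hd,
    Matrix.conjTranspose_conjTranspose, ← h2]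
  calc _ = Y * (Matrix.diagonal (fun i => (s i : ℂ)) * ((X.conjTranspose * X) *
        (Matrix.diagonal (fun i => (s i : ℂ)) * Y.conjTranspose))) := by
        simp only [Matrix.mul_assoc]
    _ = _ := by
        rw [conjTranspose_mul_self_of_mem h.left_mem, Matrix.one_mul]
        simp only [Matrix.mul_assoc]

/-- Since `∨^k` respects products and adjoints, `∨^k Y` carries the symmetrized basis tensors to a
spanning family of eigenvectors of `(∨^k A)* ∨^k A`, with eigenvalues `∏ s (J j) ^ 2`. -/
theorem IsSVD.absRpow_symPower {A X Y : Matrix (Fin n) (Fin n) ℂ} {s : Fin n → ℝ}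
    (h : IsSVD A X Y s) (k : ℕ) {p : ℝ} (hp : 0 ≤ p) :
    absRpow (symPowerOp k A) p =
      symPowerOp k (Y * Matrix.diagonal (fun i => ((s i ^ p : ℝ) : ℂ)) * Y.conjTranspose) := by
  have key : ∀ (b : Fin n → ℂ) (J : Fin k → Fin n),
      symPowerOp k (Y * Matrix.diagonal b * Y.conjTranspose) (symPowerOp k Y (symBasisVec k J)) =
        (∏ j, b (J j)) • symPowerOp k Y (symBasisVec k J) := by
    intro b J
    have h1 : symPowerOp k (Y * Matrix.diagonal b * Y.conjTranspose) * symPowerOp k Y =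
        symPowerOp k Y * symPowerOp k (Matrix.diagonal b) := by
      rw [← symPower_mul, Matrix.mul_assoc, conjTranspose_mul_self_of_mem h.right_mem,
        Matrix.mul_one, symPower_mul]
    rw [← mul_apply_eq_comp, h1, mul_apply_eq_comp,
      symPower_diagonal_symBasisVec, map_smul]
  refine absRpow_eq_of_eigenvectors _ _ p hp (fun J => symPowerOp k Y (symBasisVec k J)) ?_
    (fun J => ∏ j, s (J j)) (fun J => Finset.prod_nonneg fun j _ => h.nonneg _)
    (fun J => ?_) (fun J => ?_)
  · rw [Set.range_comp' (symPowerOp k Y) (symBasisVec k)]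
    change Submodule.span ℂ ((symPowerOp k Y).toLinearMap '' _) = ⊤
    rw [Submodule.span_image, span_symBasisVec, Submodule.map_top, LinearMap.range_eq_top]
    intro x
    refine ⟨symPowerOp k Y.conjTranspose x, ?_⟩
    change symPowerOp k Y (symPowerOp k Y.conjTranspose x) = x
    rw [← mul_apply_eq_comp, ← symPower_mul,
      mul_conjTranspose_self_of_mem h.right_mem, symPower_one, one_apply_eq_self]
  · rw [← symPower_conjTranspose, ← symPower_mul, h.conjTranspose_mul_self, key]
    push_cast
    rw [Finset.prod_pow]
  · rw [key, ← Real.finsetProd_rpow _ _ (fun j _ => h.nonneg _)]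
    push_cast
    rfl

theorem IsSVD.schattenNorm_symPower {A X Y : Matrix (Fin n) (Fin n) ℂ} {s : Fin n → ℝ}
    (h : IsSVD A X Y s) (k : ℕ) {p : ℝ} (hp : 0 ≤ p) :
    schattenNorm p (symPowerOp k A) = completeSymm k (fun i => s i ^ p) ^ (1 / p) := by
  unfold schattenNorm
  rw [h.absRpow_symPower k hp, Matrix.mul_assoc, symPower_mul, ContinuousLinearMap.toLinearMap_mul,
    LinearMap.trace_mul_comm, ← ContinuousLinearMap.toLinearMap_mul, ← symPower_mul,
    Matrix.mul_assoc, conjTranspose_mul_self_of_mem h.right_mem, Matrix.mul_one,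
    trace_symPower_diagonal, Complex.ofReal_re]

theorem IsSVD.absRpow_toEuclideanCLM {A X Y : Matrix (Fin n) (Fin n) ℂ} {s : Fin n → ℝ}
    (h : IsSVD A X Y s) {p : ℝ} (hp : 0 ≤ p) :
    absRpow (Matrix.toEuclideanCLM (𝕜 := ℂ) A) p = Matrix.toEuclideanCLM (𝕜 := ℂ)
      (Y * Matrix.diagonal (fun i => ((s i ^ p : ℝ) : ℂ)) * Y.conjTranspose) := by
  have key : ∀ (b : Fin n → ℂ) (i : Fin n),
      Matrix.toEuclideanCLM (𝕜 := ℂ) (Y * Matrix.diagonal b * Y.conjTranspose)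
        (Matrix.toEuclideanCLM (𝕜 := ℂ) Y (EuclideanSpace.single i 1)) =
        b i • Matrix.toEuclideanCLM (𝕜 := ℂ) Y (EuclideanSpace.single i 1) := by
    intro b i
    rw [← mul_apply_eq_comp, ← map_mul, Matrix.mul_assoc,
      conjTranspose_mul_self_of_mem h.right_mem, Matrix.mul_one, map_mul,
      mul_apply_eq_comp, ← map_smul]
    congr 1
    ext j
    simp [Matrix.ofLp_toEuclideanCLM, Matrix.mulVec_diagonal, Pi.single_apply]
    split_ifs with hj <;> simp [hj]
  refine absRpow_eq_of_eigenvectors _ _ p hp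
    (fun i => Matrix.toEuclideanCLM (𝕜 := ℂ) Y (EuclideanSpace.single i 1)) ?_ s h.nonneg
    (fun i => ?_) (fun i => ?_)
  · rw [Set.range_comp' (Matrix.toEuclideanCLM (𝕜 := ℂ) Y)
      (fun i => EuclideanSpace.single i (1 : ℂ))]
    change Submodule.span ℂ ((Matrix.toEuclideanCLM (𝕜 := ℂ) Y).toLinearMap '' _) = ⊤
    have hs : Submodule.span ℂ (Set.range fun i : Fin n => EuclideanSpace.single i (1 : ℂ)) = ⊤ := by
      have := (EuclideanSpace.basisFun (Fin n) ℂ).toBasis.span_eq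
      rw [OrthonormalBasis.coe_toBasis] at this
      have he : (fun i : Fin n => EuclideanSpace.single i (1 : ℂ)) =
          EuclideanSpace.basisFun (Fin n) ℂ := by
        ext i
        simp
      rw [he]
      exact this
    rw [Submodule.span_image, hs, Submodule.map_top, LinearMap.range_eq_top]
    intro x
    refine ⟨Matrix.toEuclideanCLM (𝕜 := ℂ) Y.conjTranspose x, ?_⟩
    change Matrix.toEuclideanCLM (𝕜 := ℂ) Y (Matrix.toEuclideanCLM (𝕜 := ℂ) Y.conjTranspose x) = x
    rw [← mul_apply_eq_comp, ← map_mul,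
      mul_conjTranspose_self_of_mem h.right_mem, map_one, one_apply_eq_self]
  · rw [← map_star, ← map_mul, Matrix.star_eq_conjTranspose, h.conjTranspose_mul_self, key]
  · rw [key]

/-- The isometry of `ℂⁿ` given by a unitary matrix. -/
noncomputable def unitaryIsometry (U : Matrix (Fin n) (Fin n) ℂ)
    (hU : U ∈ Matrix.unitaryGroup (Fin n) ℂ) :
    EuclideanSpace ℂ (Fin n) ≃ₗᵢ[ℂ] EuclideanSpace ℂ (Fin n) :=
  Unitary.linearIsometryEquiv ⟨Matrix.toEuclideanCLM (𝕜 := ℂ) U,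
    by rw [Unitary.mem_iff, ← map_star, ← map_mul, ← map_mul, Matrix.mem_unitaryGroup_iff'.1 hU,
        Matrix.mem_unitaryGroup_iff.1 hU, map_one]; exact ⟨rfl, rfl⟩⟩

theorem unitaryIsometry_apply (U : Matrix (Fin n) (Fin n) ℂ)
    (hU : U ∈ Matrix.unitaryGroup (Fin n) ℂ) (x : EuclideanSpace ℂ (Fin n)) :
    unitaryIsometry U hU x = Matrix.toEuclideanCLM (𝕜 := ℂ) U x := rfl

theorem conjTranspose_mem_unitaryGroup {U : Matrix (Fin n) (Fin n) ℂ}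
    (hU : U ∈ Matrix.unitaryGroup (Fin n) ℂ) :
    U.conjTranspose ∈ Matrix.unitaryGroup (Fin n) ℂ := Unitary.star_mem hU

theorem re_inner_unitary_conj_diagonal {Y : Matrix (Fin n) (Fin n) ℂ}
    (hY : Y ∈ Matrix.unitaryGroup (Fin n) ℂ) (b : Fin n → ℝ) (x : EuclideanSpace ℂ (Fin n)) :
    (inner ℂ (Matrix.toEuclideanCLM (𝕜 := ℂ)
      (Y * Matrix.diagonal (fun i => (b i : ℂ)) * Y.conjTranspose) x) x).re =
    ∑ i, b i * ‖unitaryIsometry _ (conjTranspose_mem_unitaryGroup hY) x i‖ ^ 2 := by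
  have h1 : (Matrix.toEuclideanCLM (𝕜 := ℂ) Y) =
      ContinuousLinearMap.adjoint (Matrix.toEuclideanCLM (𝕜 := ℂ) Y.conjTranspose) := by
    rw [← ContinuousLinearMap.star_eq_adjoint, ← map_star, Matrix.star_eq_conjTranspose,
      Matrix.conjTranspose_conjTranspose]
  rw [Matrix.mul_assoc, map_mul, mul_apply_eq_comp, h1,
    ContinuousLinearMap.adjoint_inner_left, map_mul, mul_apply_eq_comp,
    ← unitaryIsometry_apply _ (conjTranspose_mem_unitaryGroup hY)]
  set y := unitaryIsometry _ (conjTranspose_mem_unitaryGroup hY) x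
  rw [PiLp.inner_apply, Complex.re_sum]
  refine Finset.sum_congr rfl fun i _ => ?_
  rw [Matrix.ofLp_toEuclideanCLM, Matrix.mulVec_diagonal, ← smul_eq_mul, inner_smul_left,
    inner_self_eq_norm_sq_to_K]
  simp [← Complex.ofReal_pow]

theorem IsSVD.sphereNorm_eq {A X Y : Matrix (Fin n) (Fin n) ℂ} {s : Fin n → ℝ}
    (h : IsSVD A X Y s) (k : ℕ) {p : ℝ} (hp : 0 ≤ p) :
    sphereNorm k p A = (∫ ξ : Metric.sphere (0 : EuclideanSpace ℂ (Fin n)) 1,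
      (∑ i, s i ^ p * ‖unitaryIsometry _ (conjTranspose_mem_unitaryGroup h.right_mem) ξ.1 i‖ ^ 2)
        ^ k ∂sphereMeasure n) ^ (1 / (p * k)) := by
  unfold sphereNorm
  rw [h.absRpow_toEuclideanCLM hp]
  simp only [re_inner_unitary_conj_diagonal h.right_mem]

end SingularValues

variable {n : ℕ}

/-! ### Existence of singular value decompositions -/

section Existence

theorem inner_toLp_column (M : Matrix (Fin n) (Fin n) ℂ) (i j : Fin n) :
    inner ℂ (WithLp.toLp 2 (M.col i)) (WithLp.toLp 2 (M.col j)) = (M.conjTranspose * M) i j := by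
  simp [PiLp.inner_apply, Matrix.mul_apply, mul_comm]

/-- A matrix with orthogonal columns is a unitary matrix times a nonnegative diagonal matrix. -/
theorem exists_unitary_mul_diagonal (M : Matrix (Fin n) (Fin n) ℂ) (s : Fin n → ℝ)
    (h : M.conjTranspose * M = Matrix.diagonal fun i => ((s i ^ 2 : ℝ) : ℂ)) :
    ∃ X ∈ Matrix.unitaryGroup (Fin n) ℂ, M = X * Matrix.diagonal fun i => (s i : ℂ) := by
  -- The nonzero columns, normalized, are orthonormal and extend to an orthonormal basis; the added
  -- vectors are harmless, being multiplied by `s j = 0`.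
  let v : Fin n → EuclideanSpace ℂ (Fin n) := fun i => ((s i : ℂ)⁻¹) • WithLp.toLp 2 (M.col i)
  have hv : Orthonormal ℂ (Set.domRestrict {i | s i ≠ 0} v) := by
    rw [orthonormal_iff_ite]
    rintro ⟨i, hi⟩ ⟨j, hj⟩
    simp only [Set.domRestrict_apply, v, inner_smul_left, inner_smul_right, inner_toLp_column, h,
      Subtype.mk.injEq, Matrix.diagonal_apply]
    have hi' : (s i : ℂ) ≠ 0 := by exact_mod_cast hi
    split_ifs with hij
    · subst hij
      simp only [map_inv₀, Complex.conj_ofReal]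
      push_cast
      field_simp
    · simp
  obtain ⟨b, hb⟩ := hv.exists_orthonormalBasis_extension_of_card_eq (by simp)
  refine ⟨(EuclideanSpace.basisFun (Fin n) ℂ).toBasis.toMatrix b,
    OrthonormalBasis.toMatrix_orthonormalBasis_mem_unitary _ _, ?_⟩
  ext i j
  rw [Matrix.mul_diagonal, Module.Basis.toMatrix_apply]
  simp only [OrthonormalBasis.coe_toBasis_repr_apply, EuclideanSpace.basisFun_repr]
  by_cases hj : s j = 0
  · have h0 : inner ℂ (WithLp.toLp 2 (M.col j)) (WithLp.toLp 2 (M.col j)) = 0 := by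
      rw [inner_toLp_column, h, Matrix.diagonal_apply_eq, hj]
      simp
    rw [inner_self_eq_zero] at h0
    have h1 := congrArg (fun x : EuclideanSpace ℂ (Fin n) => x i) h0
    simp only [Matrix.col_apply, PiLp.zero_apply] at h1
    simp [h1, hj]
  · have hj' : (s j : ℂ) ≠ 0 := by exact_mod_cast hj
    rw [hb j hj]
    simp only [v, PiLp.smul_apply, Matrix.col_apply, smul_eq_mul]
    field_simp

-- If the unitary `Y` diagonalizes `A* A`, then `A Y` has orthogonal columns, whose lengths are the
-- square roots of the eigenvalues.
open scoped ComplexOrder in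
theorem exists_isSVD (A : Matrix (Fin n) (Fin n) ℂ) : ∃ X Y s, IsSVD A X Y s := by
  have hP := Matrix.posSemidef_conjTranspose_mul_self A
  let Y : Matrix (Fin n) (Fin n) ℂ := hP.isHermitian.eigenvectorUnitary
  have hY : Y ∈ Matrix.unitaryGroup (Fin n) ℂ := hP.isHermitian.eigenvectorUnitary.2
  let s : Fin n → ℝ := fun i => Real.sqrt (hP.isHermitian.eigenvalues i)
  have hs : A.conjTranspose * A =
      Y * (Matrix.diagonal fun i => ((s i ^ 2 : ℝ) : ℂ)) * Y.conjTranspose := by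
    conv_lhs => rw [hP.isHermitian.spectral_theorem, Unitary.conjStarAlgAut_apply]
    simp only [s, Real.sq_sqrt (hP.eigenvalues_nonneg _)]
    rfl
  have hYY := conjTranspose_mul_self_of_mem hY
  obtain ⟨X, hX, h⟩ := exists_unitary_mul_diagonal (A * Y) s (by
    rw [Matrix.conjTranspose_mul]
    calc _ = Y.conjTranspose * (A.conjTranspose * A) * Y := by simp only [Matrix.mul_assoc]
      _ = (Y.conjTranspose * Y) * (Matrix.diagonal fun i => ((s i ^ 2 : ℝ) : ℂ)) *
          (Y.conjTranspose * Y) := by rw [hs]; simp only [Matrix.mul_assoc]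
      _ = _ := by rw [hYY, Matrix.one_mul, Matrix.mul_one])
  refine ⟨X, Y, s, hX, hY, fun i => Real.sqrt_nonneg _, ?_⟩
  rw [← h, Matrix.mul_assoc, mul_conjTranspose_self_of_mem hY, Matrix.mul_one]

end Existence

/-! ### Doubly stochastic domination -/

section Stochastic

theorem sum_norm_sq_row {U : Matrix (Fin n) (Fin n) ℂ} (hU : U ∈ Matrix.unitaryGroup (Fin n) ℂ)
    (i : Fin n) : ∑ j, ‖U i j‖ ^ 2 = 1 := by
  have h := congrFun (congrFun (mul_conjTranspose_self_of_mem hU) i) i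
  simp only [Matrix.mul_apply, Matrix.conjTranspose_apply, Matrix.one_apply_eq,
    RCLike.star_def, Complex.mul_conj'] at h
  exact_mod_cast h

theorem sum_norm_sq_col {U : Matrix (Fin n) (Fin n) ℂ} (hU : U ∈ Matrix.unitaryGroup (Fin n) ℂ)
    (j : Fin n) : ∑ i, ‖U i j‖ ^ 2 = 1 := by
  have h := sum_norm_sq_row (conjTranspose_mem_unitaryGroup hU) j
  simpa [Matrix.conjTranspose_apply] using h

/-- The diagonal of `X* A Y` is dominated by a doubly stochastic image of the singular values. -/
theorem IsSVD.exists_doublyStochastic {A X Y X' Y' : Matrix (Fin n) (Fin n) ℂ} {s : Fin n → ℝ}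
    (h : IsSVD A X Y s) (hX' : X' ∈ Matrix.unitaryGroup (Fin n) ℂ)
    (hY' : Y' ∈ Matrix.unitaryGroup (Fin n) ℂ) :
    ∃ D ∈ doublyStochastic ℝ (Fin n), ∀ i,
      ‖(X'.conjTranspose * A * Y') i i‖ ≤ (D.mulVec s) i := by
  set P := X'.conjTranspose * X with hP
  set Q := Y'.conjTranspose * Y with hQ
  have hPu : P ∈ Matrix.unitaryGroup (Fin n) ℂ :=
    mul_mem (conjTranspose_mem_unitaryGroup hX') h.left_mem
  have hQu : Q ∈ Matrix.unitaryGroup (Fin n) ℂ :=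
    mul_mem (conjTranspose_mem_unitaryGroup hY') h.right_mem
  -- From `|P i j| |Q i j| ≤ (|P i j|² + |Q i j|²) / 2`: the squared moduli of a unitary matrix are
  -- doubly stochastic, hence so is the average.
  refine ⟨Matrix.of fun i j => (‖P i j‖ ^ 2 + ‖Q i j‖ ^ 2) / 2, ?_, fun i => ?_⟩
  · rw [mem_doublyStochastic_iff_sum]
    refine ⟨fun i j => ?_, fun i => ?_, fun j => ?_⟩
    · simp only [Matrix.of_apply]
      positivity
    · simp only [Matrix.of_apply]
      rw [← Finset.sum_div, Finset.sum_add_distrib, sum_norm_sq_row hPu, sum_norm_sq_row hQu]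
      norm_num
    · simp only [Matrix.of_apply]
      rw [← Finset.sum_div, Finset.sum_add_distrib, sum_norm_sq_col hPu, sum_norm_sq_col hQu]
      norm_num
  · have h1 : X'.conjTranspose * A * Y' =
        P * Matrix.diagonal (fun i => (s i : ℂ)) * Q.conjTranspose := by
      rw [h.eq, hP, hQ, Matrix.conjTranspose_mul, Matrix.conjTranspose_conjTranspose]
      simp only [Matrix.mul_assoc]
    rw [h1, Matrix.mul_apply]
    refine (norm_sum_le _ _).trans (Finset.sum_le_sum fun j _ => ?_)
    change _ ≤ (‖P i j‖ ^ 2 + ‖Q i j‖ ^ 2) / 2 * s j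
    rw [Matrix.mul_diagonal, Matrix.conjTranspose_apply, norm_mul, norm_mul, norm_star,
      Complex.norm_real, Real.norm_of_nonneg (h.nonneg j)]
    nlinarith [mul_nonneg (h.nonneg j) (sq_nonneg (‖P i j‖ - ‖Q i j‖))]

end Stochastic

/-! ### The symmetric gauge function -/

section Gauge

/-- The symmetric gauge function `s ↦ h_k(s^p)^{1/(pk)}`. -/
noncomputable def gauge (k : ℕ) (p : ℝ) (s : Fin n → ℝ) : ℝ :=
  completeSymm k (fun i => s i ^ p) ^ (1 / (p * k))

variable {k : ℕ} {p : ℝ}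

theorem gauge_comp_perm (s : Fin n → ℝ) (e : Equiv.Perm (Fin n)) :
    gauge k p (s ∘ e) = gauge k p s := by
  unfold gauge
  exact congrArg (· ^ (1 / (p * k))) (completeSymm_comp_perm k (fun i => s i ^ p) e)

theorem gauge_nonneg {s : Fin n → ℝ} (hs : ∀ i, 0 ≤ s i) : 0 ≤ gauge k p s :=
  Real.rpow_nonneg (completeSymm_nonneg k fun i => Real.rpow_nonneg (hs i) p) _

theorem gauge_smul (hk : 1 ≤ k) (hp : 0 < p) {c : ℝ} (hc : 0 ≤ c) {s : Fin n → ℝ}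
    (hs : ∀ i, 0 ≤ s i) : gauge k p (fun i => c * s i) = c * gauge k p s := by
  have hk' : (0 : ℝ) < k := by exact_mod_cast hk
  unfold gauge
  simp only [Real.mul_rpow hc (hs _), completeSymm_smul]
  rw [Real.mul_rpow (by positivity) (completeSymm_nonneg k fun i => Real.rpow_nonneg (hs i) p),
    ← Real.rpow_natCast, ← Real.rpow_mul hc, ← Real.rpow_mul hc, mul_one_div_cancel (by positivity),
    Real.rpow_one]

theorem completeSymm_mono {b c : Fin n → ℝ} (hb : ∀ i, 0 ≤ b i) (h : ∀ i, b i ≤ c i) :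
    completeSymm k b ≤ completeSymm k c := by
  unfold completeSymm
  gcongr with I _ j _
  · exact fun j _ => hb _
  · exact h _

theorem gauge_mono (hp : 0 ≤ p) {s t : Fin n → ℝ} (hs : ∀ i, 0 ≤ s i) (h : ∀ i, s i ≤ t i) :
    gauge k p s ≤ gauge k p t :=
  Real.rpow_le_rpow (completeSymm_nonneg k fun i => Real.rpow_nonneg (hs i) p)
    (completeSymm_mono (fun i => Real.rpow_nonneg (hs i) p)
      fun i => Real.rpow_le_rpow (hs i) (h i) hp) (by positivity)

theorem eq_zero_of_gauge_eq_zero (hk : 1 ≤ k) (hp : 0 < p) {s : Fin n → ℝ} (hs : ∀ i, 0 ≤ s i)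
    (h : gauge k p s = 0) (i : Fin n) : s i = 0 := by
  have hk' : (0 : ℝ) < k := by exact_mod_cast hk
  have hb : ∀ i, 0 ≤ s i ^ p := fun i => Real.rpow_nonneg (hs i) p
  have h1 := (Real.rpow_eq_zero (completeSymm_nonneg k hb) (by positivity)).1 h
  have h2 := pow_le_completeSymm k hb i
  rw [h1] at h2
  have h3 : (s i ^ p) ^ k = 0 := le_antisymm h2 (pow_nonneg (hb i) k)
  exact (Real.rpow_eq_zero (hs i) hp.ne').1 (pow_eq_zero_iff (by omega) |>.1 h3)

theorem gauge_zero (hk : 1 ≤ k) (hp : 0 < p) : gauge k p (0 : Fin n → ℝ) = 0 := by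
  have := gauge_smul (n := n) hk hp (c := 0) le_rfl (s := 0) (fun _ => le_rfl)
  simp only [zero_mul] at this
  exact this

theorem memLp_of_continuous {X : Type*} [TopologicalSpace X] [CompactSpace X] [MeasurableSpace X]
    [BorelSpace X] {μ : Measure X} [IsFiniteMeasure μ] {f : X → ℝ} (hf : Continuous f)
    (q : ENNReal) : MemLp f q μ := by
  obtain ⟨C, hC⟩ := isCompact_univ.exists_bound_of_continuousOn hf.continuousOn
  exact MemLp.of_bound hf.aestronglyMeasurable C
    (Filter.Eventually.of_forall fun x => hC x (Set.mem_univ x))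

/-- Minkowski's inequality for nonnegative continuous functions on a compact space. -/
theorem integral_rpow_add_le {X : Type*} [TopologicalSpace X] [CompactSpace X] [MeasurableSpace X]
    [BorelSpace X] {μ : Measure X} [IsFiniteMeasure μ] {f g : X → ℝ} (hf : Continuous f)
    (hg : Continuous g) (hf0 : ∀ x, 0 ≤ f x) (hg0 : ∀ x, 0 ≤ g x) {q : ℝ} (hq : 1 ≤ q) :
    (∫ x, (f x + g x) ^ q ∂μ) ^ (1 / q) ≤
      (∫ x, f x ^ q ∂μ) ^ (1 / q) + (∫ x, g x ^ q ∂μ) ^ (1 / q) := by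
  have key : ∀ h : X → ℝ, Continuous h → (∀ x, 0 ≤ h x) →
      eLpNorm h (ENNReal.ofReal q) μ = ENNReal.ofReal ((∫ x, h x ^ q ∂μ) ^ (1 / q)) := by
    intro h hc h0
    rw [(memLp_of_continuous hc _).eLpNorm_eq_integral_rpow_norm (by simp; linarith)
      ENNReal.ofReal_ne_top, ENNReal.toReal_ofReal (by linarith), one_div]
    simp only [Real.norm_of_nonneg (h0 _)]
  have hI : ∀ h : X → ℝ, (∀ x, 0 ≤ h x) → 0 ≤ (∫ x, h x ^ q ∂μ) ^ (1 / q) := fun h h0 =>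
    Real.rpow_nonneg (integral_nonneg fun x => Real.rpow_nonneg (h0 x) q) _
  have h1 := eLpNorm_add_le (μ := μ) hf.aestronglyMeasurable hg.aestronglyMeasurable
    (p := ENNReal.ofReal q) (by simpa using hq)
  rw [key _ hf hf0, key _ hg hg0, key _ (hf.add hg) fun x => add_nonneg (hf0 x) (hg0 x),
    ← ENNReal.ofReal_add (hI f hf0) (hI g hg0),
    ENNReal.ofReal_le_ofReal_iff (add_nonneg (hI f hf0) (hI g hg0))] at h1
  exact h1

/-- Placing the weight `|ξ_i|^(2/p)` inside the `p`-th power makes the integrand the `pk`-th power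
of an `ℓ^p` norm that depends linearly on `s` inside, the form Minkowski's inequality needs. -/
theorem gauge_eq_integral (hn : 0 < n) (hp : 0 < p) {s : Fin n → ℝ}
    (hs : ∀ i, 0 ≤ s i) :
    gauge k p s = ((n + k - 1).choose k : ℝ) ^ (1 / (p * k)) *
      (∫ ξ : Metric.sphere (0 : EuclideanSpace ℂ (Fin n)) 1,
        ((∑ i, (s i * (‖ξ.1 i‖ ^ 2) ^ (1 / p)) ^ p) ^ (1 / p)) ^ (p * k) ∂sphereMeasure n)
          ^ (1 / (p * k)) := by
  have h0 : ∀ ξ : Metric.sphere (0 : EuclideanSpace ℂ (Fin n)) 1,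
      ((∑ i, (s i * (‖ξ.1 i‖ ^ 2) ^ (1 / p)) ^ p) ^ (1 / p)) ^ (p * k) =
        (∑ i, s i ^ p * ‖ξ.1 i‖ ^ 2) ^ k := by
    intro ξ
    have h1 : ∀ i, (s i * (‖ξ.1 i‖ ^ 2) ^ (1 / p)) ^ p = s i ^ p * ‖ξ.1 i‖ ^ 2 := fun i => by
      rw [Real.mul_rpow (hs i) (by positivity), ← Real.rpow_mul (by positivity),
        one_div_mul_cancel hp.ne', Real.rpow_one]
    simp only [h1]
    have h2 : 0 ≤ ∑ i, s i ^ p * ‖ξ.1 i‖ ^ 2 :=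
      Finset.sum_nonneg fun i _ => mul_nonneg (Real.rpow_nonneg (hs i) p) (by positivity)
    rw [← Real.rpow_mul h2, ← mul_assoc, one_div_mul_cancel hp.ne', one_mul, Real.rpow_natCast]
  simp only [h0]
  rw [← Real.mul_rpow (by positivity) (integral_nonneg fun ξ => pow_nonneg (Finset.sum_nonneg
    fun i _ => mul_nonneg (Real.rpow_nonneg (hs i) p) (by positivity)) k)]
  unfold gauge
  rw [← choose_mul_integral_sphere n k hn _ (LinearIsometryEquiv.refl ℂ _)]
  rfl

theorem gauge_add_le (hk : 1 ≤ k) (hp : 1 ≤ p) {s t : Fin n → ℝ} (hs : ∀ i, 0 ≤ s i)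
    (ht : ∀ i, 0 ≤ t i) : gauge k p (s + t) ≤ gauge k p s + gauge k p t := by
  have hp0 : 0 < p := by linarith
  have hk' : (1 : ℝ) ≤ k := by exact_mod_cast hk
  rcases Nat.eq_zero_or_pos n with rfl | hn
  · rw [Subsingleton.elim (s + t) 0, Subsingleton.elim s 0, Subsingleton.elim t 0,
      gauge_zero hk hp0]
    simp
  rw [gauge_eq_integral hn hp0 hs, gauge_eq_integral hn hp0 ht,
    gauge_eq_integral hn hp0 (s := s + t) fun i => add_nonneg (hs i) (ht i), ← mul_add]
  refine mul_le_mul_of_nonneg_left ?_ (by positivity)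
  have hnn : ∀ {u : Fin n → ℝ}, (∀ i, 0 ≤ u i) →
      ∀ (ξ : Metric.sphere (0 : EuclideanSpace ℂ (Fin n)) 1) i,
        0 ≤ u i * (‖ξ.1 i‖ ^ 2) ^ (1 / p) := fun hu ξ i => mul_nonneg (hu i) (by positivity)
  have hF : ∀ {u : Fin n → ℝ}, (∀ i, 0 ≤ u i) →
      ∀ ξ : Metric.sphere (0 : EuclideanSpace ℂ (Fin n)) 1,
        0 ≤ (∑ i, (u i * (‖ξ.1 i‖ ^ 2) ^ (1 / p)) ^ p) ^ (1 / p) := fun hu ξ =>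
    Real.rpow_nonneg (Finset.sum_nonneg fun i _ => Real.rpow_nonneg (hnn hu ξ i) p) _
  have hc : ∀ u : Fin n → ℝ,
      Continuous fun ξ : Metric.sphere (0 : EuclideanSpace ℂ (Fin n)) 1 =>
        (∑ i, (u i * (‖ξ.1 i‖ ^ 2) ^ (1 / p)) ^ p) ^ (1 / p) := by
    intro u
    refine (continuous_finsetSum _ fun i _ => ?_).rpow_const fun _ => Or.inr (by positivity)
    refine Continuous.rpow_const (continuous_const.mul ?_) fun _ => Or.inr hp0.le
    refine Continuous.rpow_const ?_ fun _ => Or.inr (by positivity)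
    fun_prop
  have hq : 1 ≤ p * k := by nlinarith
  -- Minkowski in `L^{pk}` is the outer inequality; the remaining pointwise one is Minkowski in
  -- `ℓ^p`.
  refine le_trans ?_ (integral_rpow_add_le (hc s) (hc t) (hF hs) (hF ht) hq)
  have hst : ∀ i, 0 ≤ (s + t) i := fun i => add_nonneg (hs i) (ht i)
  refine Real.rpow_le_rpow (integral_nonneg fun ξ => Real.rpow_nonneg (hF hst ξ) _) ?_
    (by positivity)
  have hint : ∀ f : Metric.sphere (0 : EuclideanSpace ℂ (Fin n)) 1 → ℝ, Continuous f →
      Integrable (fun ξ => f ξ ^ (p * k)) (sphereMeasure n) := fun f hf =>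
    memLp_one_iff_integrable.1
      (memLp_of_continuous (hf.rpow_const fun _ => Or.inr (by positivity)) 1)
  refine integral_mono (hint _ (hc _)) (hint _ ((hc s).add (hc t))) fun ξ => ?_
  refine Real.rpow_le_rpow (hF hst ξ) ?_ (by positivity)
  have := Real.Lp_add_le_of_nonneg Finset.univ hp (fun i _ => hnn hs ξ i) (fun i _ => hnn ht ξ i)
  simpa only [Pi.add_apply, add_mul] using this

/-- By Birkhoff, `D` is a convex combination of permutation matrices; subadditivity, homogeneity and
permutation invariance finish. -/
theorem gauge_mulVec_le (hk : 1 ≤ k) (hp : 1 ≤ p) {s : Fin n → ℝ} (hs : ∀ i, 0 ≤ s i)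
    {D : Matrix (Fin n) (Fin n) ℝ} (hD : D ∈ doublyStochastic ℝ (Fin n)) :
    gauge k p (D.mulVec s) ≤ gauge k p s := by
  have hp0 : 0 < p := by linarith
  obtain ⟨w, hw, hw1, rfl⟩ := exists_eq_sum_perm_of_mem_doublyStochastic hD
  have h1 : (∑ σ, w σ • Equiv.Perm.permMatrix ℝ σ).mulVec s =
      ∑ σ : Equiv.Perm (Fin n), fun i => w σ * (s ∘ σ) i := by
    rw [Matrix.sum_mulVec]
    refine Finset.sum_congr rfl fun σ _ => ?_
    rw [Matrix.smul_mulVec, Matrix.permMatrix_mulVec]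
    rfl
  rw [h1]
  refine (Finset.le_sum_of_subadditive_on_pred (gauge k p) (fun u : Fin n → ℝ => ∀ i, 0 ≤ u i)
    (gauge_zero hk hp0).le (fun u v hu hv => gauge_add_le hk hp hu hv)
    (fun u v hu hv i => add_nonneg (hu i) (hv i)) _
    fun σ _ i => mul_nonneg (hw σ) (hs _)).trans_eq ?_
  have h2 : ∀ σ : Equiv.Perm (Fin n), gauge k p (fun i => w σ * (s ∘ σ) i) = w σ * gauge k p s :=
    fun σ => by rw [gauge_smul hk hp0 (hw σ) (s := s ∘ σ) fun i => hs _, gauge_comp_perm]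
  refine (Finset.sum_congr rfl fun σ _ => h2 σ).trans ?_
  rw [← Finset.sum_mul, hw1, one_mul]

end Gauge

/-! ### The norm on matrices and the identity -/

section Norm

variable {k : ℕ} {p : ℝ}

/-- The function `A ↦ ‖∨^k A‖_{(p)}^{1/k}`. -/
noncomputable def symPowerNorm (k : ℕ) (p : ℝ) (A : Matrix (Fin n) (Fin n) ℂ) : ℝ :=
  schattenNorm (E := symTensors n k) p (symPower k A) ^ (1 / k : ℝ)

theorem IsSVD.symPowerNorm_eq {A X Y : Matrix (Fin n) (Fin n) ℂ} {s : Fin n → ℝ}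
    (h : IsSVD A X Y s) (hp : 0 ≤ p) : symPowerNorm k p A = gauge k p s := by
  have h1 : symPowerNorm k p A = schattenNorm p (symPowerOp k A) ^ (1 / k : ℝ) := rfl
  rw [h1, h.schattenNorm_symPower k hp, ← Real.rpow_mul
    (completeSymm_nonneg k fun i => Real.rpow_nonneg (h.nonneg i) p), gauge, one_div_mul_one_div]

theorem symPowerNorm_add_le (hk : 1 ≤ k) (hp : 1 ≤ p) (A B : Matrix (Fin n) (Fin n) ℂ) :
    symPowerNorm k p (A + B) ≤ symPowerNorm k p A + symPowerNorm k p B := by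
  have hp0 : 0 ≤ p := by linarith
  obtain ⟨X, Y, c, hc⟩ := exists_isSVD (A + B)
  obtain ⟨X₁, Y₁, a, ha⟩ := exists_isSVD A
  obtain ⟨X₂, Y₂, b, hb⟩ := exists_isSVD B
  obtain ⟨D₁, hD₁, h₁⟩ := ha.exists_doublyStochastic hc.left_mem hc.right_mem
  obtain ⟨D₂, hD₂, h₂⟩ := hb.exists_doublyStochastic hc.left_mem hc.right_mem
  rw [hc.symPowerNorm_eq hp0, ha.symPowerNorm_eq hp0, hb.symPowerNorm_eq hp0]
  have h : ∀ i, c i ≤ (D₁.mulVec a + D₂.mulVec b) i := by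
    intro i
    -- In the singular frames of `A + B`, its singular values are diagonal entries, hence sums of
    -- those of `A` and `B` there.
    have h1 : X.conjTranspose * A * Y + X.conjTranspose * B * Y =
        Matrix.diagonal fun i => (c i : ℂ) := by
      rw [← Matrix.add_mul, ← Matrix.mul_add, hc.eq]
      calc _ = (X.conjTranspose * X) * (Matrix.diagonal fun i => (c i : ℂ)) *
            (Y.conjTranspose * Y) := by simp only [Matrix.mul_assoc]
        _ = _ := by
          rw [conjTranspose_mul_self_of_mem hc.left_mem,
            conjTranspose_mul_self_of_mem hc.right_mem, Matrix.one_mul, Matrix.mul_one]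
    have h2 := congrArg norm (congrFun (congrFun h1 i) i)
    rw [Matrix.diagonal_apply_eq, Complex.norm_real, Real.norm_of_nonneg (hc.nonneg i),
      Matrix.add_apply] at h2
    rw [← h2]
    exact (norm_add_le _ _).trans (add_le_add (h₁ i) (h₂ i))
  refine (gauge_mono hp0 hc.nonneg h).trans ?_
  refine (gauge_add_le hk hp (fun i => (norm_nonneg _).trans (h₁ i))
    fun i => (norm_nonneg _).trans (h₂ i)).trans ?_
  exact add_le_add (gauge_mulVec_le hk hp ha.nonneg hD₁) (gauge_mulVec_le hk hp hb.nonneg hD₂)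

theorem symPowerNorm_smul (hk : 1 ≤ k) (hp : 0 < p) (c : ℂ) (A : Matrix (Fin n) (Fin n) ℂ) :
    symPowerNorm k p (c • A) = ‖c‖ * symPowerNorm k p A := by
  obtain ⟨X, Y, s, h⟩ := exists_isSVD A
  -- The phase of `c` is absorbed into the left unitary factor, leaving singular values scaled by
  -- `‖c‖`.
  obtain ⟨u, hu, hc⟩ : ∃ u : ℂ, u * star u = 1 ∧ c = u * ‖c‖ := by
    by_cases h0 : c = 0
    · exact ⟨1, by simp, by simp [h0]⟩
    · have hn : (‖c‖ : ℂ) ≠ 0 := by simpa using h0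
      refine ⟨c / ‖c‖, ?_, by field_simp⟩
      rw [RCLike.star_def, Complex.mul_conj', norm_div]
      simp [h0]
  have h' : IsSVD (c • A) (u • X) Y fun i => ‖c‖ * s i := by
    refine ⟨?_, h.right_mem, fun i => mul_nonneg (norm_nonneg _) (h.nonneg i), ?_⟩
    · rw [Matrix.mem_unitaryGroup_iff, star_smul, Matrix.smul_mul, Matrix.mul_smul, smul_smul, hu,
        one_smul, Matrix.mem_unitaryGroup_iff.1 h.left_mem]
    · have hd : (Matrix.diagonal fun i => ((‖c‖ * s i : ℝ) : ℂ)) =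
          (‖c‖ : ℂ) • Matrix.diagonal fun i => (s i : ℂ) := by
        ext i j
        by_cases hij : i = j <;> simp [hij]
      rw [hd, h.eq, Matrix.smul_mul, Matrix.smul_mul, Matrix.mul_smul, Matrix.smul_mul,
        smul_smul, ← hc]
  rw [h'.symPowerNorm_eq hp.le, h.symPowerNorm_eq hp.le,
    gauge_smul hk hp (norm_nonneg c) h.nonneg]

theorem isUnitarilyInvariantNorm_symPowerNorm (hk : 1 ≤ k) (hp : 1 ≤ p) :
    IsUnitarilyInvariantNorm (symPowerNorm (n := n) k p) where
  nonneg A := by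
    obtain ⟨X, Y, s, h⟩ := exists_isSVD A
    rw [h.symPowerNorm_eq (by linarith)]
    exact gauge_nonneg h.nonneg
  eq_zero_iff A := by
    constructor
    · intro h0
      obtain ⟨X, Y, s, h⟩ := exists_isSVD A
      rw [h.symPowerNorm_eq (by linarith)] at h0
      have hs := eq_zero_of_gauge_eq_zero hk (by linarith) h.nonneg h0
      rw [h.eq]
      simp [hs]
    · rintro rfl
      have := symPowerNorm_smul (n := n) hk (p := p) (by linarith) 0 0
      simpa using this
  smul c A := symPowerNorm_smul hk (by linarith) c A
  add_le A B := symPowerNorm_add_le hk hp A B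
  unitary_mul_mul A U hU V hV := by
    obtain ⟨X, Y, s, h⟩ := exists_isSVD A
    have h' : IsSVD (U * A * V) (U * X) (V.conjTranspose * Y) s := by
      refine ⟨mul_mem hU h.left_mem, mul_mem (conjTranspose_mem_unitaryGroup hV) h.right_mem,
        h.nonneg, ?_⟩
      rw [Matrix.conjTranspose_mul, Matrix.conjTranspose_conjTranspose, h.eq]
      simp only [Matrix.mul_assoc]
    rw [h.symPowerNorm_eq (by linarith), h'.symPowerNorm_eq (by linarith)]

theorem choose_rpow_mul_sphereNorm (hk : 1 ≤ k) (hp : 0 < p) (A : Matrix (Fin n) (Fin n) ℂ) :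
    ((n + k - 1).choose k : ℝ) ^ (1 / (k * p)) * sphereNorm k p A = symPowerNorm k p A := by
  have hk' : (0 : ℝ) < k := by exact_mod_cast hk
  obtain ⟨X, Y, s, h⟩ := exists_isSVD A
  rw [h.symPowerNorm_eq hp.le]
  rcases Nat.eq_zero_or_pos n with rfl | hn
  -- For `n = 0` the binomial coefficient is `(k-1).choose k = 0`, and both sides vanish.
  · rw [Nat.choose_eq_zero_of_lt (by omega), Nat.cast_zero, Real.zero_rpow (by positivity),
      zero_mul, Subsingleton.elim s 0, gauge_zero hk hp]
  rw [h.sphereNorm_eq k hp.le, mul_comm (k : ℝ) p, ← Real.mul_rpow (by positivity)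
    (integral_nonneg fun ξ => pow_nonneg (Finset.sum_nonneg
      fun i _ => mul_nonneg (Real.rpow_nonneg (h.nonneg i) p) (by positivity)) k),
    choose_mul_integral_sphere n k hn]
  rfl

end Norm

end SymPower

theorem mainTheorem6 (n k : ℕ) (hk : 1 ≤ k) (p : ℝ) (hp : 1 ≤ p) :
    (∀ A : Matrix (Fin n) (Fin n) ℂ,
      ((n + k - 1).choose k : ℝ) ^ (1 / (k * p)) * SymPower.sphereNorm k p A =
        SymPower.schattenNorm (E := SymPower.symTensors n k) p (SymPower.symPower k A)
          ^ (1 / k : ℝ)) ∧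
    SymPower.IsUnitarilyInvariantNorm (fun A : Matrix (Fin n) (Fin n) ℂ =>
      SymPower.schattenNorm (E := SymPower.symTensors n k) p (SymPower.symPower k A)
        ^ (1 / k : ℝ)) :=
  ⟨fun A => SymPower.choose_rpow_mul_sphereNorm hk (by linarith) A,
    SymPower.isUnitarilyInvariantNorm_symPowerNorm hk hp⟩
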